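/- Corollary 1.2. All spaces are Tychonoff. Let $X$ be a space admitting a continuous transitive action $G\times X\to X$ of an $\omega$-narrow topological group $G$; that is, for every neighbourhood $U$ of the neutral element of $G$ there is a countable set $A\subset G$ with $UA=AU=G$. (1) If $X$ contains a dense subset which, as a subspace, is Čech-complete and $k$-separable, then $X$ is skeletally Dugundji. (2) If $X$ is Čech-complete and $\sigma$-compact, then $X$ is openly Dugundji. Here a Tychonoff space is Čech-complete if it is a $G_\delta$-set in its Stone–Čech compactification, and a space is $k$-separable if it contains a dense $\sigma$-compact set. A continuous map $f:Y\to Z$ is skeletal if $\operatorname{Int}\overline{f(U)}\neq\varnothing$ for every nonempty open $U\subset Y$. A space $X$ is skeletally (resp., openly) Dugundji if there are a nonzero cardinal $\tau$ and an inverse system $S=\{X_\alpha,p^\beta_\alpha,\alpha<\beta<\tau\}$ of Tychonoff spaces, indexed by the ordinals below $\tau$, with continuous surjective skeletal (resp., open) bonding maps $p^\beta_\alpha:X_\beta\to X_\alpha$, such that: (i) $X_0$ is separable metrizable, and whenever $\alpha+1<\tau$ there are a separable metrizable space $M_\alpha$ and a topological embedding of $X_{\alpha+1}$ into $X_\alpha\times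 M_\alpha$ under which $p^{\alpha+1}_\alpha$ is the restriction of the projection onto $X_\alpha$; (ii) for every limit ordinal $\gamma<\tau$ the canonical map $X_\gamma\to\varprojlim\{X_\alpha,p^\beta_\alpha,\alpha<\beta<\gamma\}$ is a topological embedding with dense image; (iii) there is a topological embedding $e:X\to\varprojlim S$ with $p_\alpha(e(X))=X_\alpha$ for every $\alpha<\tau$, where $p_\alpha:\varprojlim S\to X_\alpha$ is the limit projection; (iv) for every bounded continuous $f:\varprojlim S\to\mathbb R$ there are $\alpha<\tau$ and a continuous $g:X_\alpha\to\mathbb R$ with $f=g\circ p_\alpha$. -/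

import Mathlib

universe u v

/-- A group with a topology is `ω`-narrow if for every neighbourhood `U` of the neutral element
there is a countable set `A` with `U A = A U = G`. -/
def IsOmegaNarrow (G : Type u) [Group G] [TopologicalSpace G] : Prop :=
  ∀ U ∈ nhds (1 : G), ∃ A : Set G, A.Countable ∧
    Set.image2 (· * ·) U A = Set.univ ∧ Set.image2 (· * ·) A U = Set.univ

/-- A space is Čech-complete if it is Tychonoff and is a `G_δ`-set in its Stone–Čech
compactification. -/
def IsCechComplete (X : Type u) [TopologicalSpace X] : Prop :=
  T35Space X ∧ IsGδ (Set.range (stoneCechUnit : X → StoneCech X))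

/-- A space is `k`-separable if it contains a dense `σ`-compact set. -/
def IsKSeparable (X : Type u) [TopologicalSpace X] : Prop :=
  ∃ K : Set X, IsSigmaCompact K ∧ Dense K

/-- A continuous map is skeletal if the closure of the image of every nonempty open set has
nonempty interior. -/
def IsSkeletal {X : Type u} {Y : Type v} [TopologicalSpace X] [TopologicalSpace Y]
    (f : X → Y) : Prop :=
  Continuous f ∧
    ∀ U : Set X, IsOpen U → U.Nonempty → (interior (closure (f '' U))).Nonempty

/-- A map `p : Y → X` has metrizable kernel if for some separable metrizable space `M` there is a
topological embedding of `Y` into `X × M` which carries `p` to the projection `X × M → X`. -/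
def HasMetrizableKernel {X Y : Type u} [TopologicalSpace X] [TopologicalSpace Y]
    (p : Y → X) : Prop :=
  ∃ (M : Type u) (_ : TopologicalSpace M) (e : Y → X × M),
    TopologicalSpace.MetrizableSpace M ∧ TopologicalSpace.SeparableSpace M ∧
      Topology.IsEmbedding e ∧ ∀ y, (e y).1 = p y

/-- A well-ordered inverse system of Tychonoff spaces with continuous surjective bonding maps,
indexed by a nonzero cardinal `τ`. The ordinals below `τ` are represented by a nonempty
well-ordered type whose order type is an initial ordinal. -/
structure WellOrderedSystem where
  /-- the set of indices -/
  Index : Type u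
  [linearOrder : LinearOrder Index]
  [wellFoundedLT : WellFoundedLT Index]
  [nonempty : Nonempty Index]
  /-- the order type of the set of indices is a cardinal -/
  ord_card_eq : (Cardinal.mk Index).ord = Ordinal.type (fun a b : Index => a < b)
  /-- the spaces -/
  Obj : Index → Type u
  [topology : ∀ a, TopologicalSpace (Obj a)]
  [tychonoff : ∀ a, T35Space (Obj a)]
  /-- the bonding maps -/
  map : ∀ ⦃a b : Index⦄, a ≤ b → Obj b → Obj a
  map_self : ∀ (a : Index) (x : Obj a), map (le_refl a) x = x
  map_map : ∀ ⦃a b c : Index⦄ (hab : a ≤ b) (hbc : b ≤ c) (x : Obj c),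
    map hab (map hbc x) = map (hab.trans hbc) x
  continuous_map : ∀ ⦃a b : Index⦄ (h : a ≤ b), Continuous (map h)
  surjective_map : ∀ ⦃a b : Index⦄ (h : a ≤ b), Function.Surjective (map h)

namespace WellOrderedSystem

attribute [instance] linearOrder wellFoundedLT nonempty topology tychonoff

/-- The inverse limit of the whole system, a subspace of the product. -/
def Limit (S : WellOrderedSystem.{u}) : Type u :=
  {x : ∀ a, S.Obj a // ∀ ⦃a b : S.Index⦄ (h : a ≤ b), S.map h (x b) = x a}

instance (S : WellOrderedSystem.{u}) : TopologicalSpace S.Limit :=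
  inferInstanceAs (TopologicalSpace
    {x : ∀ a, S.Obj a // ∀ ⦃a b : S.Index⦄ (h : a ≤ b), S.map h (x b) = x a})

/-- The limit projections. -/
def proj (S : WellOrderedSystem.{u}) (a : S.Index) (x : S.Limit) : S.Obj a := x.1 a

/-- The inverse limit of the part of the system below the index `c`. -/
def LimitBelow (S : WellOrderedSystem.{u}) (c : S.Index) : Type u :=
  {x : ∀ a : Set.Iio c, S.Obj a //
    ∀ ⦃a b : Set.Iio c⦄ (h : (a : S.Index) ≤ b), S.map h (x b) = x a}

instance (S : WellOrderedSystem.{u}) (c : S.Index) : TopologicalSpace (S.LimitBelow c) :=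
  inferInstanceAs (TopologicalSpace {x : ∀ a : Set.Iio c, S.Obj a //
    ∀ ⦃a b : Set.Iio c⦄ (h : (a : S.Index) ≤ b), S.map h (x b) = x a})

/-- The canonical map of the space with index `c` to the inverse limit of the preceding spaces. -/
def toLimitBelow (S : WellOrderedSystem.{u}) (c : S.Index) (x : S.Obj c) : S.LimitBelow c :=
  ⟨fun a => S.map (le_of_lt a.2) x, fun _ b h => S.map_map h (le_of_lt b.2) x⟩

/-- The first space is separable metrizable, and the bonding maps between consecutive spaces
have metrizable kernels. -/
def HasMetrizableSteps (S : WellOrderedSystem.{u}) : Prop :=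
  (∀ a : S.Index, IsMin a →
    TopologicalSpace.MetrizableSpace (S.Obj a) ∧ TopologicalSpace.SeparableSpace (S.Obj a)) ∧
  ∀ ⦃a b : S.Index⦄ (h : a ⋖ b), HasMetrizableKernel (S.map h.le)

/-- At limit indices the space is, by the canonical map, a dense subspace of the inverse limit
of the preceding spaces. -/
def IsAlmostContinuous (S : WellOrderedSystem.{u}) : Prop :=
  ∀ c : S.Index, Order.IsSuccLimit c → IsDenseEmbedding (S.toLimitBelow c)

/-- `X` is embedded in the inverse limit so that it projects onto every space of the system. -/
def IsAlmostLimit (S : WellOrderedSystem.{u}) (X : Type u) [TopologicalSpace X] : Prop :=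
  ∃ e : X → S.Limit, Topology.IsEmbedding e ∧
    ∀ a : S.Index, Function.Surjective fun x => S.proj a (e x)

/-- Every bounded continuous real-valued function on the inverse limit factors through some
space of the system. -/
def IsFactorizing (S : WellOrderedSystem.{u}) : Prop :=
  ∀ f : BoundedContinuousFunction S.Limit ℝ, ∃ (a : S.Index) (g : C(S.Obj a, ℝ)),
    ∀ x : S.Limit, f x = g (S.proj a x)

end WellOrderedSystem

/-- Skeletally Dugundji spaces. -/
def IsSkeletallyDugundji (X : Type u) [TopologicalSpace X] : Prop :=
  ∃ S : WellOrderedSystem.{u},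
    (∀ ⦃a b : S.Index⦄ (h : a ≤ b), IsSkeletal (S.map h)) ∧
      S.HasMetrizableSteps ∧ S.IsAlmostContinuous ∧ S.IsAlmostLimit X ∧ S.IsFactorizing

/-- Openly Dugundji spaces. -/
def IsOpenlyDugundji (X : Type u) [TopologicalSpace X] : Prop :=
  ∃ S : WellOrderedSystem.{u},
    (∀ ⦃a b : S.Index⦄ (h : a ≤ b), IsOpenMap (S.map h)) ∧
      S.HasMetrizableSteps ∧ S.IsAlmostContinuous ∧ S.IsAlmostLimit X ∧ S.IsFactorizing

open Set Topology Filter unitInterval Uniformity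

/-! A chain of families of continuous functions `X → I` gives an inverse system of images of `X` in
cubes. If the chain starts countable, grows by countable pieces, takes unions at limits and
stabilizes at a family that embeds `X`, all conditions but the one on bonding maps are formal; and
the bonding maps are skeletal or open once the maps from `X` are.

Those maps are controlled by Baire category (`IsOmegaNarrow.closure_image_mem_nhds`): if the action
descends to a Baire image, countably many translates of a small piece of an orbit cover it, so one
has a closure with interior, and the action moves this to any point. For `X` itself this shows that
the functions moved little by group elements near 1 determine the topology
(`exists_mem_uniformFamily`). By narrowness such a function has countably many translates that are
uniformly dense in its orbit; unions of these countable sets form the chain, and the action descends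
to their images.

The images are Baire because a dense Čech-complete `D` is a `G_δ` in the compact space given by all
these functions: countably many of them (`exists_countable_separating_family`), put into every
family, make each image contain a dense `G_δ` of a compact space. If the compact sets cover `X`, the
maps are also closed, hence open. -/

/-- The map of `X` to the cube given by a family `A` of functions. -/
def familyMap {X : Type u} [TopologicalSpace X] (A : Set C(X, I)) (x : X) : A → I :=
  fun f => f.1 x

/-- The image of `X` in the cube under the map given by a family `A` of functions. -/
abbrev FamilyImage {X : Type u} [TopologicalSpace X] (A : Set C(X, I)) : Type u :=
  range (familyMap A)

/-! ### Images of `X` in cubes. -/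

namespace FamilyImage

variable {X : Type u} [TopologicalSpace X] {A B C : Set C(X, I)}

/-- The canonical map of `X` onto the image given by a family of functions. -/
def toImage (A : Set C(X, I)) (x : X) : FamilyImage A := ⟨familyMap A x, x, rfl⟩

theorem continuous_familyMap (A : Set C(X, I)) : Continuous (familyMap A) :=
  continuous_pi fun f => f.1.continuous

theorem continuous_toImage (A : Set C(X, I)) : Continuous (toImage A) :=
  (continuous_familyMap A).subtype_mk _

theorem surjective_toImage (A : Set C(X, I)) : Function.Surjective (toImage A) := by
  rintro ⟨_, x, rfl⟩
  exact ⟨x, rfl⟩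

/-- The canonical map between the images given by two families of functions. -/
def proj (h : A ⊆ B) (y : FamilyImage B) : FamilyImage A :=
  ⟨fun f => y.1 ⟨f.1, h f.2⟩, by
    obtain ⟨_, x, rfl⟩ := y
    exact ⟨x, rfl⟩⟩

theorem continuous_proj (h : A ⊆ B) : Continuous (proj h) :=
  Continuous.subtype_mk (continuous_pi fun f =>
    (continuous_apply (⟨f.1, h f.2⟩ : B)).comp continuous_subtype_val) _

theorem surjective_proj (h : A ⊆ B) : Function.Surjective (proj h) := fun y => by
  obtain ⟨x, rfl⟩ := surjective_toImage A y
  exact ⟨toImage B x, rfl⟩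

/-- Reduces skeletality and openness of bonding maps to those of the maps from `X`. -/
theorem image_proj (h : A ⊆ B) (U : Set (FamilyImage B)) :
    proj h '' U = toImage A '' (toImage B ⁻¹' U) := by
  conv_lhs => rw [← image_preimage_eq U (surjective_toImage B), image_image]
  rfl

/-- The coordinates in `A` and in the countable `C` together recover all coordinates in `B`, so the
metrizable factor can be the cube `C → I`. -/
theorem hasMetrizableKernel_proj (h : A ⊆ B) (hC : C.Countable) (hB : B ⊆ A ∪ C) (hCB : C ⊆ B) :
    HasMetrizableKernel (proj h) := by
  have := hC.to_subtype
  classical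
  let e : FamilyImage B → FamilyImage A × (C → I) :=
    fun y => (proj h y, fun f => y.1 ⟨f.1, hCB f.2⟩)
  have he : Continuous e := (continuous_proj h).prodMk
    (continuous_pi fun f => (continuous_apply _).comp continuous_subtype_val)
  let r : FamilyImage A × (C → I) → (B → I) := fun y f =>
    if hf : f.1 ∈ A then y.1.1 ⟨f.1, hf⟩ else y.2 ⟨f.1, (hB f.2).resolve_left hf⟩
  have hr : Continuous r := continuous_pi fun f => by
    by_cases hf : f.1 ∈ A
    · simp only [r, hf, dite_true]
      exact (continuous_apply _).comp (continuous_subtype_val.comp continuous_fst)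
    · simp only [r, hf, dite_false]
      exact (continuous_apply _).comp continuous_snd
  have hre : r ∘ e = Subtype.val := by
    funext y f
    by_cases hf : f.1 ∈ A
    · simp only [Function.comp_apply, r, hf, dite_true]
      rfl
    · simp only [Function.comp_apply, r, hf, dite_false]
      rfl
  exact ⟨C → I, inferInstance, e, inferInstance, inferInstance,
    IsEmbedding.of_comp he hr (hre ▸ IsEmbedding.subtypeVal), fun _ => rfl⟩

end FamilyImage

/-! ### Inverse systems from chains of families. -/

open FamilyImage

/-- A family of functions which grows along a well-ordered set of indices. -/
structure FamilyChain (X : Type u) [TopologicalSpace X] where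
  /-- the set of indices -/
  Index : Type u
  [linearOrder : LinearOrder Index]
  [wellFoundedLT : WellFoundedLT Index]
  [nonempty : Nonempty Index]
  ord_card_eq : (Cardinal.mk Index).ord = Ordinal.type (fun a b : Index => a < b)
  /-- the families -/
  family : Index → Set C(X, I)
  monotone_family : Monotone family

namespace FamilyChain

attribute [instance] linearOrder wellFoundedLT nonempty

variable {X : Type u} [TopologicalSpace X]

/-- The well-ordered system of images of `X` given by a chain of families. -/
abbrev system (F : FamilyChain X) : WellOrderedSystem.{u} where
  Index := F.Index
  ord_card_eq := F.ord_card_eq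
  Obj a := FamilyImage (F.family a)
  map _ _ h := proj (F.monotone_family h)
  map_self _ _ := rfl
  map_map _ _ _ _ _ _ := rfl
  continuous_map _ _ _ := continuous_proj _
  surjective_map _ _ _ := surjective_proj _

/-- The canonical map of `X` to the limit of the system given by a chain of families. -/
def toLimit (F : FamilyChain X) (x : X) : F.system.Limit :=
  ⟨fun a => toImage (F.family a) x, fun _ _ _ => rfl⟩

theorem continuous_toLimit (F : FamilyChain X) : Continuous F.toLimit :=
  (continuous_pi fun a => continuous_toImage (F.family a)).subtype_mk _

theorem continuous_system_proj (F : FamilyChain X) (a : F.Index) :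
    Continuous (F.system.proj a) :=
  (continuous_apply a).comp continuous_subtype_val

theorem isEmbedding_toLimit (F : FamilyChain X) {t : F.Index}
    (ht : IsEmbedding (toImage (F.family t))) : IsEmbedding F.toLimit :=
  IsEmbedding.of_comp F.continuous_toLimit (F.continuous_system_proj t) ht

theorem isAlmostLimit (F : FamilyChain X) {t : F.Index}
    (ht : IsEmbedding (toImage (F.family t))) : F.system.IsAlmostLimit X :=
  ⟨F.toLimit, F.isEmbedding_toLimit ht, fun a => surjective_toImage (F.family a)⟩

/-- A thread is determined by its coordinate at `t`, where the largest family sits. The space there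
is a copy of `X`, so every thread comes from a point of `X`. -/
theorem isFactorizing (F : FamilyChain X) {t : F.Index}
    (ht : IsEmbedding (toImage (F.family t))) (hmax : ∀ a, F.family a ⊆ F.family t) :
    F.system.IsFactorizing := by
  intro f
  let h : X ≃ₜ FamilyImage (F.family t) := ht.toHomeomorphOfSurjective (surjective_toImage _)
  refine ⟨t, ⟨fun y => f (F.toLimit (h.symm y)),
    f.continuous.comp (F.continuous_toLimit.comp h.symm.continuous)⟩, fun x => ?_⟩
  change f x = f (F.toLimit (h.symm (x.1 t)))
  congr 1
  have hx : toImage (F.family t) (h.symm (x.1 t)) = x.1 t := h.apply_symm_apply _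
  apply Subtype.ext
  funext a
  change x.1 a = toImage (F.family a) _
  have key : proj (hmax a) (x.1 t) = x.1 a := by
    rcases le_total a t with hat | hta
    · exact x.2 hat
    · rw [← x.2 hta]
      rfl
  exact key.symm.trans (congrArg (proj (hmax a)) hx.symm)

/-- Each coordinate at a limit index occurs earlier, which gives the embedding. For density, a basic
open set restricts finitely many indices, and a point of `X` that matches the thread at their
maximum matches it at all of them. -/
theorem isAlmostContinuous (F : FamilyChain X)
    (hlim : ∀ c, Order.IsSuccLimit c → F.family c ⊆ ⋃ a < c, F.family a) :
    F.system.IsAlmostContinuous := by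
  intro c hc
  have hcont : Continuous (F.system.toLimitBelow c) :=
    (continuous_pi fun a => F.system.continuous_map _).subtype_mk _
  have hcoord : ∀ f : F.family c, ∃ a : {a : F.Index // a < c}, f.1 ∈ F.family a.1 := fun f => by
    obtain ⟨a, hac, hf⟩ := mem_iUnion₂.1 (hlim c hc f.2)
    exact ⟨⟨a, hac⟩, hf⟩
  choose s hs using hcoord
  let r : F.system.LimitBelow c → (F.family c → I) := fun x f => (x.1 (s f)).1 ⟨f.1, hs f⟩
  have hr : Continuous r := continuous_pi fun f =>
    (continuous_apply (⟨f.1, hs f⟩ : F.family (s f).1)).comp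
      (continuous_subtype_val.comp ((continuous_apply (s f)).comp continuous_subtype_val))
  have hemb : IsEmbedding (F.system.toLimitBelow c) :=
    IsEmbedding.of_comp hcont hr IsEmbedding.subtypeVal
  refine ⟨⟨hemb.1, ?_⟩, hemb.2⟩
  intro x
  rw [mem_closure_iff_nhds]
  intro V hV
  obtain ⟨V', hV', hVV'⟩ := mem_nhds_induced Subtype.val x V |>.1 hV
  rw [nhds_pi, Filter.mem_pi] at hV'
  obtain ⟨J, hJ, U, hU, hUV⟩ := hV'
  obtain ⟨m, hm⟩ : ∃ m : Iio c, ∀ j ∈ J, j ≤ m := by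
    have : Nonempty (Iio c) := by
      obtain ⟨b, hb⟩ := not_isMin_iff.1 hc.1
      exact ⟨⟨b, hb⟩⟩
    exact hJ.bddAbove
  obtain ⟨z, hz⟩ := surjective_toImage (F.family m.1) (x.1 m)
  refine ⟨F.system.toLimitBelow c (toImage (F.family c) z), hVV' (hUV fun j hj => ?_),
    mem_range_self _⟩
  have : (F.system.toLimitBelow c (toImage (F.family c) z)).1 j = x.1 j := by
    rw [← x.2 (hm j hj), ← hz]
    rfl
  rw [this]
  exact mem_of_mem_nhds (hU j)

theorem hasMetrizableSteps (F : FamilyChain X)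
    (hmin : ∀ a, IsMin a → (F.family a).Countable)
    (hsucc : ∀ a b, a ⋖ b → ∃ C : Set C(X, I), C.Countable ∧ F.family b = F.family a ∪ C) :
    F.system.HasMetrizableSteps := by
  refine ⟨fun a ha => ?_, fun a b h => ?_⟩
  · have := (hmin a ha).to_subtype
    exact ⟨inferInstanceAs (TopologicalSpace.MetrizableSpace (FamilyImage (F.family a))),
      inferInstanceAs (TopologicalSpace.SeparableSpace (FamilyImage (F.family a)))⟩
  · obtain ⟨C, hC, hb⟩ := hsucc a b h
    exact hasMetrizableKernel_proj (F.monotone_family h.le) hC hb.subset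
      (subset_union_right.trans hb.superset)

theorem isSkeletal_map (F : FamilyChain X)
    (h : ∀ a, IsSkeletal (toImage (F.family a))) ⦃a b : F.system.Index⦄ (hab : a ≤ b) :
    IsSkeletal (F.system.map hab) := by
  refine ⟨F.system.continuous_map hab, fun U hU hne => ?_⟩
  change (interior (closure (proj (F.monotone_family hab) '' U))).Nonempty
  rw [image_proj]
  exact (h a).2 _ (hU.preimage (continuous_toImage _)) (hne.preimage (surjective_toImage _))

theorem isOpenMap_map (F : FamilyChain X)
    (h : ∀ a, IsOpenMap (toImage (F.family a))) ⦃a b : F.system.Index⦄ (hab : a ≤ b) :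
    IsOpenMap (F.system.map hab) := by
  intro U hU
  change IsOpen (proj (F.monotone_family hab) '' U)
  rw [image_proj]
  exact h a _ (hU.preimage (continuous_toImage _))

end FamilyChain

/-! ### Chains indexed by an initial ordinal. -/

/-- Every type injects into a proper initial segment of an initial ordinal. -/
theorem exists_injective_bounded_initial (ι : Type u) :
    ∃ (J : Type u) (_ : LinearOrder J) (_ : WellFoundedLT J) (φ : ι → J) (t : J),
      (Cardinal.mk J).ord = Ordinal.type (fun a b : J => a < b) ∧ Function.Injective φ ∧
        ∀ i, φ i < t := by
  -- Passing to the successor cardinal leaves room for `t`, the initial ordinal of `ι`, above all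
  -- values of the injection.
  let κ := Order.succ (Cardinal.mk ι)
  have hlt : (Cardinal.mk ι).ord < κ.ord := Cardinal.ord_lt_ord.2 (Order.lt_succ _)
  obtain ⟨E⟩ := Cardinal.eq.1 (Cardinal.mk_ord_toType (Cardinal.mk ι)).symm
  refine ⟨κ.ord.ToType, inferInstance, inferInstance,
    fun i => Ordinal.ToType.mk ⟨(Ordinal.ToType.mk.symm (E i)).1,
      mem_Iio.2 (lt_trans (mem_Iio.1 (Ordinal.ToType.mk.symm (E i)).2) hlt)⟩,
    Ordinal.ToType.mk ⟨_, hlt⟩, ?_, ?_, ?_⟩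
  · rw [Cardinal.mk_ord_toType]
    exact (Ordinal.type_toType _).symm
  · intro i j hij
    have := Subtype.ext_iff.1 (Ordinal.ToType.mk.injective hij)
    exact E.injective (Ordinal.ToType.mk.symm.injective (Subtype.ext this))
  · intro i
    exact Ordinal.ToType.mk.lt_iff_lt.2 (Ordinal.ToType.mk.symm (E i)).2

/-- A family which is a union of countable families, and which determines the topology of `X`,
gives a chain of unions of the countable families. The set of indices is longer than the set of
countable families, so that the chain is eventually constant. -/
theorem exists_familyChain_of_countable {X : Type u} [TopologicalSpace X] {ι : Type u}
    {Φ₀ : Set C(X, I)} (hΦ₀ : Φ₀.Countable) {Φ : ι → Set C(X, I)} (hΦ : ∀ i, (Φ i).Countable)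
    (hemb : IsEmbedding (toImage (Φ₀ ∪ ⋃ i, Φ i))) :
    ∃ F : FamilyChain X,
      (∀ a, ∃ J : Set ι, F.family a = Φ₀ ∪ ⋃ i ∈ J, Φ i) ∧ F.system.HasMetrizableSteps ∧
        F.system.IsAlmostContinuous ∧ F.system.IsAlmostLimit X ∧ F.system.IsFactorizing := by
  obtain ⟨J, hJ, hwf, φ, t, hord, hinj, ht⟩ := exists_injective_bounded_initial ι
  have : Nonempty J := ⟨t⟩
  let F : FamilyChain X :=
    { Index := J
      ord_card_eq := hord
      family := fun a => Φ₀ ∪ ⋃ i ∈ {i | φ i < a}, Φ i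
      monotone_family := fun a b hab => union_subset_union_right _
        (biUnion_subset_biUnion_left fun i (hi : φ i < a) => hi.trans_le hab) }
  have htop : F.family t = Φ₀ ∪ ⋃ i, Φ i := by
    change Φ₀ ∪ ⋃ i ∈ {i | φ i < t}, Φ i = _
    simp [ht]
  have hmax : ∀ a, F.family a ⊆ F.family t := fun a => by
    rw [htop]
    exact union_subset_union_right _ (iUnion₂_subset fun i _ => subset_iUnion Φ i)
  have hemb' : IsEmbedding (toImage (F.family t)) := by rwa [htop]
  refine ⟨F, fun a => ⟨_, rfl⟩, F.hasMetrizableSteps ?_ ?_, F.isAlmostContinuous ?_,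
    F.isAlmostLimit hemb', F.isFactorizing hemb' hmax⟩
  · intro a ha
    change (Φ₀ ∪ ⋃ i ∈ {i | φ i < a}, Φ i).Countable
    have : {i | φ i < a} = ∅ := eq_empty_of_forall_notMem fun i hi => ha.not_lt hi
    simpa [this] using hΦ₀
  · intro a b hab
    -- As `φ` is injective, at most one countable family enters at each step.
    refine ⟨⋃ i ∈ {i | φ i = a}, Φ i, Countable.biUnion ?_ fun i _ => hΦ i, ?_⟩
    · exact (subsingleton_singleton.preimage hinj : (φ ⁻¹' {a}).Subsingleton).countable
    · change Φ₀ ∪ ⋃ i ∈ {i | φ i < b}, Φ i = (Φ₀ ∪ ⋃ i ∈ {i | φ i < a}, Φ i) ∪ _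
      rw [union_assoc, ← biUnion_union]
      have : {i | φ i < b} = {i | φ i < a} ∪ {i | φ i = a} := by
        ext i
        simp only [mem_ofPred_eq, mem_union, ← le_iff_lt_or_eq]
        exact ⟨fun h => not_lt.1 fun h' => hab.2 h' h, fun h => h.trans_lt hab.1⟩
      rw [this]
  · rintro c hc f (hf | hf)
    · obtain ⟨b, hb⟩ := not_isMin_iff.1 hc.1
      exact mem_iUnion₂.2 ⟨b, hb, Or.inl hf⟩
    · obtain ⟨i, hi, hf⟩ := mem_iUnion₂.1 hf
      obtain ⟨a, hac, hia⟩ := hc.2.lt_iff_exists_lt.1 hi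
      exact mem_iUnion₂.2 ⟨a, hac, Or.inr (mem_iUnion₂.2 ⟨i, hia, hf⟩)⟩

/-! ### Baire category and densely open orbit maps. -/

/-- A space with a dense Baire subspace is Baire. -/
theorem Topology.IsInducing.baireSpace_of_denseRange {Z : Type u} {Y : Type v}
    [TopologicalSpace Z] [TopologicalSpace Y] [BaireSpace Z] {f : Z → Y} (hf : IsInducing f)
    (hd : DenseRange f) : BaireSpace Y := by
  refine ⟨fun U hU hUd => ?_⟩
  have hpre : ∀ n, Dense (f ⁻¹' U n) := fun n => by
    rw [dense_iff_inter_open]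
    intro V hV hne
    obtain ⟨V', hV', rfl⟩ := hf.isOpen_iff.1 hV
    obtain ⟨z, hz⟩ := hne
    obtain ⟨y, hyV, hyU⟩ := (hUd n).inter_open_nonempty V' hV' ⟨_, hz⟩
    obtain ⟨z', hz'⟩ := hd.exists_mem_open (hV'.inter (hU n)) ⟨y, hyV, hyU⟩
    exact ⟨z', hz'.1, hz'.2⟩
  have hdense := BaireSpace.baire_property _ (fun n => (hU n).preimage hf.continuous) hpre
  refine (hd.dense_image hf.continuous hdense).mono ?_
  rintro _ ⟨z, hz, rfl⟩
  exact mem_iInter.2 fun n => mem_iInter.1 hz n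

/-- A transitive action of an `ω`-narrow group which descends to a Baire image is, on the image,
densely open. -/
theorem IsOmegaNarrow.closure_image_mem_nhds {G : Type v} [Group G] [TopologicalSpace G]
    [IsTopologicalGroup G] (hG : IsOmegaNarrow G) {X Y : Type u} [MulAction G X]
    [MulAction.IsPretransitive G X] [TopologicalSpace Y] [BaireSpace Y] {p : X → Y}
    (hp : Function.Surjective p)
    (hact : ∀ g : G, ∃ h : Y → Y, Continuous h ∧ ∀ x, h (p x) = p (g • x))
    {U : Set G} (hU : U ∈ 𝓝 (1 : G)) (x : X) :
    closure (p '' ((fun g : G => g • x) '' U)) ∈ 𝓝 (p x) := by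
  choose h hcont hh using hact
  have hinv : ∀ g y, h g (h g⁻¹ y) = y := fun g y => by
    obtain ⟨z, rfl⟩ := hp y
    rw [hh, hh, smul_inv_smul]
  let e : G → Y ≃ₜ Y := fun g =>
    { toFun := h g
      invFun := h g⁻¹
      left_inv := fun y => by simpa using hinv g⁻¹ y
      right_inv := hinv g
      continuous_toFun := hcont g
      continuous_invFun := hcont g⁻¹ }
  obtain ⟨V, hV, -, hVi, hVU⟩ := exists_closed_nhds_one_inv_eq_mul_subset hU
  obtain ⟨A, hA, -, hAV⟩ := hG V hV
  have := hA.to_subtype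
  let S : Set Y := p '' ((fun g : G => g • x) '' V)
  have hcover : ⋃ a : A, closure (e a.1 '' S) = univ := by
    refine eq_univ_of_forall fun y => ?_
    obtain ⟨z, rfl⟩ := hp y
    obtain ⟨g, rfl⟩ := MulAction.exists_smul_eq G x z
    obtain ⟨a, ha, v, hv, rfl⟩ := hAV.superset (mem_univ g)
    refine mem_iUnion.2 ⟨⟨a, ha⟩, subset_closure ⟨p (v • x), ⟨_, ⟨v, hv, rfl⟩, rfl⟩, ?_⟩⟩
    change h a _ = _
    rw [hh, smul_smul]
  have : Nonempty Y := ⟨p x⟩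
  obtain ⟨a, ha⟩ := nonempty_interior_of_iUnion_of_closed (fun _ => isClosed_closure) hcover
  rw [← (e a.1).image_closure, ← (e a.1).image_interior, image_nonempty] at ha
  -- `S` meets the interior of its closure at some `p (v • x)`; translation by `v⁻¹` brings this
  -- point to `p x` and keeps the set inside the image of `U`.
  obtain ⟨_, ⟨_, ⟨v, hv, rfl⟩, rfl⟩, hy⟩ := (closure_inter_open_nonempty_iff isOpen_interior).1
    (ha.mono (subset_inter interior_subset subset_rfl))
  have hx : p x ∈ e v⁻¹ '' interior (closure S) := ⟨_, hy, by
    change h v⁻¹ (p (v • x)) = _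
    rw [hh, inv_smul_smul]⟩
  rw [(e v⁻¹).image_interior, (e v⁻¹).image_closure] at hx
  refine mem_of_superset (isOpen_interior.mem_nhds hx) (interior_subset.trans (closure_mono ?_))
  rintro _ ⟨_, ⟨_, ⟨w, hw, rfl⟩, rfl⟩, rfl⟩
  refine ⟨_, ⟨v⁻¹ * w, hVU (mul_mem_mul (hVi ▸ inv_mem_inv.2 hv) hw), rfl⟩, ?_⟩
  change _ = h v⁻¹ (p (w • x))
  rw [hh, smul_smul]

/-! ### Functions moved little by small group elements. -/

/-- A sequence of reflexive relations, each symmetric up to and each composable within the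
preceding one, comes from a pseudometric. -/
theorem exists_pseudoMetricSpace_of_seq {X : Type u} (R : ℕ → Set (X × X)) (hR : Antitone R)
    (hrefl : ∀ n x, (x, x) ∈ R n) (hsymm : ∀ n x y, (x, y) ∈ R (n + 1) → (y, x) ∈ R n)
    (hcomp : ∀ n x y z, (x, y) ∈ R (n + 1) → (y, z) ∈ R (n + 1) → (x, z) ∈ R n) :
    ∃ d : PseudoMetricSpace X, (∀ ε > 0, ∃ n, ∀ x y, (x, y) ∈ R n → d.dist x y < ε) ∧
      ∀ n, ∃ ε > 0, ∀ x y, d.dist x y < ε → (x, y) ∈ R n := by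
  let B : FilterBasis (X × X) :=
    { sets := range R
      nonempty := range_nonempty R
      inter_sets := by
        rintro _ _ ⟨m, rfl⟩ ⟨n, rfl⟩
        exact ⟨_, ⟨max m n, rfl⟩,
          subset_inter (hR (le_max_left m n)) (hR (le_max_right m n))⟩ }
  let C : UniformSpace.Core X := UniformSpace.Core.mkOfBasis B
    (by rintro _ ⟨n, rfl⟩ x; exact hrefl n x)
    (by rintro _ ⟨n, rfl⟩; exact ⟨_, ⟨n + 1, rfl⟩, fun p hp => hsymm n _ _ hp⟩)
    (by
      rintro _ ⟨n, rfl⟩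
      refine ⟨_, ⟨n + 1, rfl⟩, ?_⟩
      rintro ⟨x, z⟩ ⟨y, hxy, hyz⟩
      exact hcomp n x y z hxy hyz)
  let _ : UniformSpace X := UniformSpace.ofCore C
  have hbasis : (𝓤 X).HasBasis (fun s : Set (X × X) => s ∈ B) id := B.hasBasis
  have : IsCountablyGenerated (𝓤 X) :=
    HasCountableBasis.isCountablyGenerated ⟨hbasis, countable_range R⟩
  let d := UniformSpace.pseudoMetricSpace X
  refine ⟨d, fun ε hε => ?_, fun n => ?_⟩
  · obtain ⟨_, ⟨n, rfl⟩, hn⟩ := hbasis.mem_iff.1 (Metric.dist_mem_uniformity hε)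
    exact ⟨n, fun x y hxy => hn hxy⟩
  · obtain ⟨ε, hε, h⟩ := Metric.mem_uniformity_dist.1 (hbasis.mem_of_mem ⟨n, rfl⟩)
    exact ⟨ε, hε, fun x y hxy => h hxy⟩

section UniformFamily

variable (G : Type v) [Group G] [TopologicalSpace G] (X : Type u) [TopologicalSpace X]
  [MulAction G X]

/-- The functions on a `G`-space which are moved little by all group elements near the neutral
element. -/
def uniformFamily : Set C(X, I) :=
  {f | ∀ ε > 0, ∃ U ∈ 𝓝 (1 : G), ∀ u ∈ U, ∀ x, dist (f (u • x)) (f x) < ε}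

variable {G X}

theorem mem_uniformFamily_iff_tendsto {f : C(X, I)} :
    f ∈ uniformFamily G X ↔
      Tendsto (fun p : G × X => (f (p.1 • p.2), f p.2)) (𝓝 1 ×ˢ ⊤) (𝓤 I) := by
  rw [Metric.uniformity_basis_dist.tendsto_right_iff]
  refine forall₂_congr fun ε hε => ?_
  rw [Filter.Eventually, mem_prod_top]
  constructor
  · rintro ⟨U, hU, h⟩
    exact mem_of_superset hU fun u hu x => h u hu x
  · exact fun h => ⟨_, h, fun u hu x => hu x⟩

variable [IsTopologicalGroup G] [ContinuousSMul G X]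

open scoped Pointwise in
/-- If the orbit maps are densely open, then the functions moved little by small group elements
separate points from closed sets. -/
theorem exists_mem_uniformFamily [RegularSpace X]
    (hd : ∀ U ∈ 𝓝 (1 : G), ∀ x : X, closure ((fun g : G => g • x) '' U) ∈ 𝓝 x)
    {x₀ : X} {O : Set X} (hO : O ∈ 𝓝 x₀) :
    ∃ f ∈ uniformFamily G X, f x₀ = 0 ∧ ∀ y ∉ O, f y = 1 := by
  obtain ⟨N, hN, hNc, hNO⟩ := exists_mem_nhds_isClosed_subset hO
  have hstep : ∀ U : {U : Set G // U ∈ 𝓝 1}, ∃ V : {V : Set G // V ∈ 𝓝 1},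
      V.1⁻¹ = V.1 ∧ V.1 * V.1 ⊆ U.1 := fun U => by
    obtain ⟨V, hV, -, hVi, hVU⟩ := exists_closed_nhds_one_inv_eq_mul_subset U.2
    exact ⟨⟨V, hV⟩, hVi, hVU⟩
  choose s hsi hsm using hstep
  -- This choice of the first neighbourhood forces the points `R 0`-related to `x₀` into the closed
  -- set `N`.
  have hU₀ : (fun g : G => g • x₀) ⁻¹' N ∈ 𝓝 (1 : G) :=
    (continuous_id.smul continuous_const).continuousAt (by simpa using hN)
  let U : ℕ → {U : Set G // U ∈ 𝓝 1} := fun n => n.rec ⟨_, hU₀⟩ fun _ => s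
  have hUi : ∀ n, (U (n + 1)).1⁻¹ = (U (n + 1)).1 := fun n => hsi (U n)
  have hUm : ∀ n, (U (n + 1)).1 * (U (n + 1)).1 ⊆ (U n).1 := fun n => hsm (U n)
  have hUle : ∀ n, (U (n + 1)).1 ⊆ (U n).1 := fun n g hg =>
    hUm n ⟨g, hg, 1, mem_of_mem_nhds (U (n + 1)).2, mul_one g⟩
  let R : ℕ → Set (X × X) := fun n => {p | p.2 ∈ closure ((fun g : G => g • p.1) '' (U n).1)}
  have hmul : ∀ n (x : X), ∀ g ∈ (U (n + 1)).1,
      ∀ y ∈ closure ((fun g : G => g • x) '' (U (n + 1)).1),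
      g • y ∈ closure ((fun g : G => g • x) '' (U n).1) := by
    intro n x g hg y hy
    refine map_mem_closure (continuous_const_smul g) hy ?_
    rintro _ ⟨h, hh, rfl⟩
    exact ⟨g * h, hUm n (mul_mem_mul hg hh), mul_smul g h x⟩
  obtain ⟨d, hdR, hRd⟩ := exists_pseudoMetricSpace_of_seq R
    (antitone_nat_of_succ_le fun n p hp => closure_mono (image_mono (hUle n)) hp)
    (fun n x => subset_closure ⟨1, mem_of_mem_nhds (U n).2, one_smul G x⟩)
    -- Symmetry uses dense openness: the closure of the orbit piece of `y` is a neighbourhood of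
    -- `y`, so it contains some `g • x`, which `g⁻¹` carries back to `x`.
    (fun n x y hxy => by
      obtain ⟨_, hz, g, hg, rfl⟩ := mem_closure_iff_nhds.1 hxy _ (hd _ (U (n + 1)).2 y)
      have := hmul n y g⁻¹ (hUi n ▸ inv_mem_inv.2 hg) _ hz
      rwa [inv_smul_smul] at this)
    (fun n x y z hxy hyz => by
      refine closure_minimal ?_ isClosed_closure hyz
      rintro _ ⟨g, hg, rfl⟩
      exact hmul n x g hg y hxy)
  obtain ⟨ε, hε, hεR⟩ := hRd 0
  have hdist : ∀ x y, |d.dist x₀ x - d.dist x₀ y| ≤ d.dist x y := fun x y => by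
    have h₁ := d.dist_triangle x₀ x y
    have h₂ := d.dist_triangle x₀ y x
    rw [d.dist_comm y x] at h₂
    rw [abs_le]
    constructor <;> linarith
  let F : X → I := fun x => projIcc 0 1 zero_le_one (d.dist x₀ x / ε)
  have hF : ∀ x y δ, d.dist x y < ε * δ → dist (F x) (F y) < δ := fun x y δ h => by
    refine (LipschitzWith.projIcc (zero_le_one' ℝ)).dist_le_mul _ _ |>.trans_lt ?_
    rw [NNReal.coe_one, one_mul, Real.dist_eq, ← sub_div, abs_div, abs_of_pos hε, div_lt_iff₀ hε,
      mul_comm]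
    exact (hdist x y).trans_lt h
  have hcont : Continuous F := by
    rw [continuous_iff_continuousAt]
    intro x
    rw [ContinuousAt, Metric.tendsto_nhds]
    intro δ hδ
    obtain ⟨n, hn⟩ := hdR (ε * δ) (mul_pos hε hδ)
    filter_upwards [hd _ (U n).2 x] with y hy
    rw [dist_comm]
    exact hF x y δ (hn x y hy)
  refine ⟨⟨F, hcont⟩, fun δ hδ => ?_, ?_, fun y hy => ?_⟩
  · obtain ⟨n, hn⟩ := hdR (ε * δ) (mul_pos hε hδ)
    refine ⟨(U n).1, (U n).2, fun u hu x => ?_⟩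
    rw [dist_comm]
    exact hF x (u • x) δ (hn _ _ (subset_closure ⟨u, hu, rfl⟩))
  · change projIcc (0 : ℝ) 1 zero_le_one (d.dist x₀ x₀ / ε) = 0
    rw [d.dist_self, zero_div]
    exact projIcc_left _
  · refine projIcc_of_right_le zero_le_one ((one_le_div hε).2 (not_lt.1 fun h => hy (hNO ?_)))
    refine closure_minimal ?_ hNc (hεR _ _ h)
    rintro _ ⟨g, hg, rfl⟩
    exact hg

/-- The translates of a function by the elements of a suitable countable set are dense in its
orbit. -/
theorem IsOmegaNarrow.exists_countable_orbit (hG : IsOmegaNarrow G) {f : C(X, I)}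
    (hf : f ∈ uniformFamily G X) :
    ∃ c : Set C(X, I), c.Countable ∧ f ∈ c ∧ c ⊆ uniformFamily G X ∧
      ∀ f₁ ∈ c, ∀ g : G, ∀ ε > 0, ∃ f₂ ∈ c, ∀ x, dist (f₁ (g • x)) (f₂ x) < ε := by
  choose U hU hUf using fun n : ℕ => hf (1 / (n + 1)) Nat.one_div_pos_of_nat
  choose A hA hAU _ using fun n => hG (U n) (hU n)
  let t : G → C(X, I) := fun a => f.comp ⟨fun x => a • x, continuous_const_smul a⟩
  refine ⟨t '' insert 1 (⋃ n, A n), ((countable_iUnion hA).insert 1).image t,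
    ⟨1, mem_insert _ _, by ext x; simp [t]⟩, ?_, ?_⟩
  · rintro _ ⟨a, -, rfl⟩ ε hε
    obtain ⟨V, hV, hVf⟩ := hf ε hε
    -- Moving the argument by `u` before translating by `a` amounts to moving it by the conjugate of
    -- `u` afterwards.
    refine ⟨(fun u => a * u * a⁻¹) ⁻¹' V, ?_, fun u hu x => ?_⟩
    · exact ((continuous_const.mul continuous_id).mul continuous_const).continuousAt
        (by simpa using hV)
    · simpa [t, mul_smul] using hVf _ hu (a • x)
  · rintro _ ⟨a, -, rfl⟩ g ε hε
    obtain ⟨n, hn⟩ := exists_nat_one_div_lt hε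
    -- With `a * g = u * b` and `u` small, the translates of `f` by `a * g` and by `b` are uniformly
    -- close.
    obtain ⟨u, hu, b, hb, hub⟩ := (hAU n).superset (mem_univ (a * g))
    refine ⟨t b, ⟨b, Or.inr (mem_iUnion.2 ⟨n, hb⟩), rfl⟩, fun x => ?_⟩
    have hx : a • g • x = u • b • x := by
      rw [smul_smul, smul_smul]
      exact congrArg (· • x) hub.symm
    change dist (f (a • g • x)) (f (b • x)) < ε
    rw [hx]
    exact (hUf n u hu _).trans hn

end UniformFamily

/-! ### Embeddings, factorizations and descent of the action. -/

/-- A map given by a family which separates points from neighbourhoods is an embedding. -/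
theorem FamilyImage.isEmbedding_toImage {X : Type u} [TopologicalSpace X] [T0Space X]
    {A : Set C(X, I)} (hA : ∀ x : X, ∀ O ∈ 𝓝 x, ∃ f ∈ A, f x = 0 ∧ ∀ y ∉ O, f y = 1) :
    IsEmbedding (toImage A) := by
  refine IsInducing.isEmbedding (isInducing_iff_nhds.2 fun x => le_antisymm
    (map_le_iff_le_comap.1 (continuous_toImage A).continuousAt) fun O hO => ?_)
  obtain ⟨f, hf, hx, hy⟩ := hA x O hO
  have hcont : Continuous fun y : FamilyImage A => y.1 ⟨f, hf⟩ :=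
    (continuous_apply (⟨f, hf⟩ : A)).comp continuous_subtype_val
  refine ⟨{y | y.1 ⟨f, hf⟩ < 1}, (isOpen_lt hcont continuous_const).mem_nhds ?_, fun y h => ?_⟩
  · change f x < 1
    rw [hx]
    exact zero_lt_one
  · by_contra hO
    exact (ne_of_lt (show f y < 1 from h)) (hy y hO)

/-- A function which is uniformly approximated by a family factors through its image. -/
theorem FamilyImage.exists_factor {X : Type u} [TopologicalSpace X] {A : Set C(X, I)} {F : X → I}
    (hF : ∀ ε > 0, ∃ f ∈ A, ∀ x, dist (F x) (f x) < ε) :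
    ∃ k : FamilyImage A → I, Continuous k ∧ ∀ x, k (toImage A x) = F x := by
  -- The choice of preimages is harmless: points with the same image agree on all the approximating
  -- functions, hence on `F`.
  let k : FamilyImage A → I := F ∘ Function.surjInv (surjective_toImage A)
  have hk : ∀ f ∈ A, ∀ ε, (∀ x, dist (F x) (f x) < ε) →
      ∀ x, dist (k (toImage A x)) (f x) < ε := by
    intro f hf ε h x
    have : f x = f (Function.surjInv (surjective_toImage A) (toImage A x)) :=
      (congrFun (congrArg Subtype.val
        (Function.surjInv_eq (surjective_toImage A) (toImage A x))) ⟨f, hf⟩).symm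
    rw [this]
    exact h _
  refine ⟨k, continuous_of_uniform_approx_of_continuous fun u hu => ?_, fun x => ?_⟩
  · obtain ⟨ε, hε, h⟩ := Metric.mem_uniformity_dist.1 hu
    obtain ⟨f, hf, hfε⟩ := hF ε hε
    refine ⟨fun y => y.1 ⟨f, hf⟩, (continuous_apply (⟨f, hf⟩ : A)).comp continuous_subtype_val,
      fun y => h ?_⟩
    obtain ⟨x, rfl⟩ := surjective_toImage A y
    exact hk f hf ε hfε x
  · refine eq_of_forall_dist_le fun ε hε => ?_
    obtain ⟨f, hf, hfε⟩ := hF (ε / 2) (half_pos hε)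
    have h₁ := hk f hf _ hfε x
    have h₂ := hfε x
    have h₃ := dist_triangle_right (k (toImage A x)) (F x) (f x)
    linarith

/-- If a family is, up to uniform approximation, invariant, then the action descends to its
image. -/
theorem FamilyImage.exists_smul {G : Type v} [Group G] {X : Type u} [TopologicalSpace X]
    [MulAction G X] {A : Set C(X, I)}
    (hA : ∀ f ∈ A, ∀ g : G, ∀ ε > 0, ∃ f' ∈ A, ∀ x, dist (f (g • x)) (f' x) < ε) (g : G) :
    ∃ h : FamilyImage A → FamilyImage A, Continuous h ∧
      ∀ x, h (toImage A x) = toImage A (g • x) := by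
  choose k hk hkx using fun f : A => exists_factor (hA f.1 f.2 g)
  have hmem : ∀ x, (fun f => k f (toImage A x)) = (toImage A (g • x)).1 := fun x =>
    funext fun f => hkx f x
  have hrange : ∀ y, (fun f => k f y) ∈ range (familyMap A) := fun y => by
    obtain ⟨x, rfl⟩ := surjective_toImage A y
    rw [hmem]
    exact Subtype.property _
  exact ⟨fun y => ⟨fun f => k f y, hrange y⟩, (continuous_pi hk).subtype_mk _,
    fun x => Subtype.ext (hmem x)⟩

/-! ### Čech-complete spaces in compactifications. -/

/-- A Čech-complete space is a `G_δ`-set in all its compactifications. -/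
theorem IsCechComplete.isGδ_range {D : Type u} [TopologicalSpace D] (hD : IsCechComplete D)
    {B : Type u} [TopologicalSpace B] [CompactSpace B] [T2Space B] {j : D → B}
    (hj : IsInducing j) (hd : DenseRange j) : IsGδ (range j) := by
  let H := stoneCechExtend hj.continuous
  have hH : Continuous H := continuous_stoneCechExtend hj.continuous
  have hHj : ∀ d, H (stoneCechUnit d) = j d := stoneCechExtend_stoneCechUnit hj.continuous
  -- The remainder of `StoneCech D` avoids `range j`: points of `D` near `p` have images near `j d`,
  -- so they lie near `d` because `j` is inducing.
  have hrem : ∀ p d, H p = j d → p = stoneCechUnit d := by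
    intro p d hp
    by_contra hne
    obtain ⟨P, Q, hP, hQ, hpP, hdQ, hPQ⟩ := t2_separation hne
    obtain ⟨Q', hQ', hQQ'⟩ := hj.isOpen_iff.1 (hQ.preimage continuous_stoneCechUnit)
    have hdQ' : d ∈ j ⁻¹' Q' := hQQ' ▸ hdQ
    obtain ⟨d', hd'P, hd'Q⟩ := denseRange_stoneCechUnit.exists_mem_open
      (hP.inter (hQ'.preimage hH)) ⟨p, hpP, by rw [mem_preimage, hp]; exact hdQ'⟩
    rw [mem_preimage, hHj] at hd'Q
    have : d' ∈ stoneCechUnit ⁻¹' Q := hQQ' ▸ hd'Q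
    exact disjoint_left.1 hPQ hd'P this
  have hsurj : Function.Surjective H := by
    rw [← range_eq_univ, ← (isCompact_range hH).isClosed.closure_eq]
    refine (hd.mono ?_).closure_eq
    rintro _ ⟨d, rfl⟩
    exact ⟨_, hHj d⟩
  obtain ⟨O, hO, hDO⟩ := isGδ_iff_eq_iInter_nat.1 hD.2
  -- Hence the complement of `range j` is the union of the compact images of the complements of the
  -- `O n`.
  have heq : range j = ⋂ n, (H '' (O n)ᶜ)ᶜ := by
    ext b
    simp only [mem_iInter, mem_compl_iff]
    constructor
    · rintro ⟨d, rfl⟩ n ⟨p, hp, hpd⟩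
      rw [hrem p d hpd] at hp
      exact hp (mem_iInter.1 (hDO.subset (mem_range_self d)) n)
    · intro h
      obtain ⟨p, rfl⟩ := hsurj b
      obtain ⟨d, rfl⟩ := hDO.superset
        (mem_iInter.2 fun n => not_not.1 fun hp => h n ⟨p, hp, rfl⟩)
      exact ⟨d, (hHj d).symm⟩
  rw [heq]
  exact .iInter_of_isOpen fun n =>
    ((hO n).isClosed_compl.isCompact.image hH).isClosed.isOpen_compl

theorem IsCechComplete.baireSpace {D : Type u} [TopologicalSpace D] (hD : IsCechComplete D) :
    BaireSpace D := by
  have hemb : IsEmbedding (stoneCechUnit : D → StoneCech D) :=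
    t35Space_iff_isEmbedding_stoneCechUnit.1 hD.1
  have := hD.2.baireSpace_of_t2Space_locallyCompactSpace
  exact hemb.toHomeomorph.symm.baireSpace

theorem IsCechComplete.of_homeomorph {D E : Type u} [TopologicalSpace D] [TopologicalSpace E]
    (hD : IsCechComplete D) (h : D ≃ₜ E) : IsCechComplete E := by
  have := hD.1
  have hE : T35Space E := h.symm.isEmbedding.t35Space
  have hemb : IsEmbedding (stoneCechUnit : E → StoneCech E) :=
    t35Space_iff_isEmbedding_stoneCechUnit.1 hE
  refine ⟨hE, ?_⟩
  rw [← h.surjective.range_comp]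
  exact hD.isGδ_range (hemb.isInducing.comp h.isInducing)
    (denseRange_stoneCechUnit.comp h.surjective.denseRange continuous_stoneCechUnit)

/-- The closure in the cube of the image of `X` under the map given by a family. -/
abbrev FamilyClosure {X : Type u} [TopologicalSpace X] (T : Set C(X, I)) : Type u :=
  closure (range (familyMap T))

namespace FamilyClosure

variable {X : Type u} [TopologicalSpace X] {A T : Set C(X, I)}

/-- The canonical map of `X` to the compact space given by a family. -/
def of (T : Set C(X, I)) (x : X) : FamilyClosure T :=
  ⟨familyMap T x, subset_closure ⟨x, rfl⟩⟩

instance : CompactSpace (FamilyClosure T) := isCompact_iff_compactSpace.1 isClosed_closure.isCompact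

theorem continuous_of : Continuous (of T) := (continuous_familyMap T).subtype_mk _

theorem denseRange_of : DenseRange (of T) := by
  rw [DenseRange, Subtype.dense_iff, ← range_comp]
  exact subset_rfl

theorem isEmbedding_of (hT : IsEmbedding (toImage T)) : IsEmbedding (of T) :=
  IsEmbedding.of_comp continuous_of continuous_subtype_val
    (IsEmbedding.subtypeVal.comp hT : IsEmbedding (Subtype.val ∘ toImage T))

/-- The restriction of the coordinates to a smaller family. -/
def restrict (h : A ⊆ T) (b : FamilyClosure T) : A → I := fun f => b.1 ⟨f.1, h f.2⟩

theorem continuous_restrict (h : A ⊆ T) : Continuous (restrict h) :=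
  continuous_pi fun f => (continuous_apply (⟨f.1, h f.2⟩ : T)).comp continuous_subtype_val

/-- Continuous functions on the compact space given by a family restrict to functions on `X`. -/
def pullback (φ : C(FamilyClosure T, I)) : C(X, I) := φ.comp ⟨of T, continuous_of⟩

theorem restrict_pullback (h : A ⊆ T) (φ : C(FamilyClosure T, I)) (hφ : pullback φ ∈ A)
    (b : FamilyClosure T) : restrict h b ⟨_, hφ⟩ = φ b := by
  refine congrFun (denseRange_of.equalizer
    ((continuous_apply (⟨_, hφ⟩ : A)).comp (continuous_restrict h)) φ.continuous ?_) b
  rfl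

/-- The uniformity of the cube is coordinatewise, so small group elements move the map into the
compact space uniformly little, and `φ` is uniformly continuous there. Thus Urysohn functions are
available within the family. -/
theorem pullback_mem_uniformFamily {G : Type v} [Group G] [TopologicalSpace G] [MulAction G X]
    (φ : C(FamilyClosure (uniformFamily G X), I)) : pullback φ ∈ uniformFamily G X := by
  rw [mem_uniformFamily_iff_tendsto]
  have hφ : UniformContinuous φ := CompactSpace.uniformContinuous_of_continuous φ.continuous
  have he : Tendsto (fun p : G × X => (of (uniformFamily G X) (p.1 • p.2), of _ p.2))
      (𝓝 1 ×ˢ ⊤) (𝓤 _) := by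
    rw [uniformity_subtype, tendsto_comap_iff, Pi.uniformity, tendsto_iInf]
    intro f
    rw [tendsto_comap_iff]
    exact mem_uniformFamily_iff_tendsto.1 f.2
  exact Tendsto.comp hφ he

end FamilyClosure

section

open FamilyClosure

variable {X : Type u} [TopologicalSpace X] {A T : Set C(X, I)}

/-- A `G_δ`-set and a `σ`-compact subset of it in the compact space given by a family are
separated by a `G_δ`-set which depends on countably many continuous functions. -/
theorem exists_countable_separating_family {D : Set X} (hD : IsGδ (of T '' D)) {K : ℕ → Set X}
    (hK : ∀ n, IsCompact (K n)) (hKD : ∀ n, K n ⊆ D) (hT : ∀ φ, pullback (T := T) φ ∈ T) :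
    ∃ A₀ ⊆ T, A₀.Countable ∧ ∀ (A : Set C(X, I)) (hAT : A ⊆ T), A₀ ⊆ A → ∃ W : Set (A → I),
      IsGδ W ∧ (∀ b, restrict hAT b ∈ W → b ∈ of T '' D) ∧ ∀ n, ∀ x ∈ K n, familyMap A x ∈ W := by
  obtain ⟨O, hO, hDO⟩ := isGδ_iff_eq_iInter_nat.1 hD
  have hsep : ∀ n m, ∃ φ : C(FamilyClosure T, I),
      (∀ x ∈ K m, φ (of T x) = 1) ∧ ∀ b ∉ O n, φ b = 0 := by
    intro n m
    have hdisj : Disjoint (O n)ᶜ (of T '' K m) := by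
      rw [disjoint_compl_left_iff_subset]
      exact (image_mono (hKD m)).trans (hDO.subset.trans (iInter_subset O n))
    obtain ⟨f, hf0, hf1, hf⟩ := exists_continuous_zero_one_of_isClosed (hO n).isClosed_compl
      ((hK m).image continuous_of).isClosed hdisj
    exact ⟨⟨fun b => ⟨f b, hf b⟩, f.continuous.subtype_mk _⟩,
      fun x hx => Subtype.ext (hf1 ⟨x, hx, rfl⟩), fun b hb => Subtype.ext (hf0 hb)⟩
  choose φ hφ1 hφ0 using hsep
  refine ⟨range fun p : ℕ × ℕ => pullback (φ p.1 p.2), ?_, countable_range _,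
    fun A hAT hA => ?_⟩
  · rintro _ ⟨p, rfl⟩
    exact hT _
  have hφA : ∀ n m, pullback (φ n m) ∈ A := fun n m => hA ⟨(n, m), rfl⟩
  -- Off `O n` every `φ n m` vanishes, while on `K m` each `φ n m` is 1.
  refine ⟨⋂ n, ⋃ m, {y | 0 < y ⟨_, hφA n m⟩}, .iInter_of_isOpen fun n => isOpen_iUnion fun m =>
    isOpen_lt continuous_const (continuous_apply _), fun b hb => ?_, fun m x hx => ?_⟩
  · refine hDO.superset (mem_iInter.2 fun n => ?_)
    obtain ⟨m, hm⟩ := mem_iUnion.1 (mem_iInter.1 hb n)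
    by_contra hbn
    refine (ne_of_gt (show 0 < restrict hAT b ⟨_, hφA n m⟩ from hm)) ?_
    rw [restrict_pullback, hφ0 n m b hbn]
  · refine mem_iInter.2 fun n => mem_iUnion.2 ⟨m, ?_⟩
    change 0 < φ n m (of T x)
    rw [hφ1 n m x hx]
    exact zero_lt_one

/-- The trace of `W` on the compact image of the closure is a Baire `G_δ`. It lies in the image of
`X`, as only points of `D` lie over `W`, and is dense there because it contains the image of `S`. -/
theorem FamilyImage.baireSpace {hAT : A ⊆ T} {D S : Set X} (hS : Dense S) {W : Set (A → I)}
    (hW : IsGδ W) (hWD : ∀ b, restrict hAT b ∈ W → b ∈ of T '' D)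
    (hSW : ∀ x ∈ S, familyMap A x ∈ W) : BaireSpace (FamilyImage A) := by
  have : CompactSpace (range (restrict hAT)) :=
    isCompact_iff_compactSpace.1 (isCompact_range (continuous_restrict hAT))
  let V : Set (range (restrict hAT)) := Subtype.val ⁻¹' W
  have hV : IsGδ V := hW.preimage continuous_subtype_val
  have := hV.baireSpace_of_t2Space_locallyCompactSpace
  have hmem : ∀ c : V, c.1.1 ∈ range (familyMap A) := by
    rintro ⟨⟨_, b, rfl⟩, hb⟩
    obtain ⟨x, -, rfl⟩ := hWD b hb
    exact ⟨x, rfl⟩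
  let ψ : V → FamilyImage A := fun c => ⟨c.1.1, hmem c⟩
  have hψ : IsInducing ψ := by
    have hval : IsInducing fun c : V => c.1.1 := IsInducing.subtypeVal.comp IsInducing.subtypeVal
    exact IsInducing.of_comp (hval.continuous.subtype_mk _) continuous_subtype_val hval
  refine hψ.baireSpace_of_denseRange ?_
  refine ((surjective_toImage A).denseRange.dense_image (continuous_toImage A) hS).mono ?_
  rintro _ ⟨x, hx, rfl⟩
  exact ⟨⟨⟨familyMap A x, of T x, rfl⟩, hSW x hx⟩, rfl⟩

/-- No point of the compact space outside `X` lies over the image of `X`. So the compact image of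
the closure of `C` adds nothing to the image of `C` there. -/
theorem FamilyImage.isClosedMap_toImage {hAT : A ⊆ T} (hT : IsEmbedding (toImage T))
    {W : Set (A → I)} (hWT : ∀ b, restrict hAT b ∈ W → b ∈ range (of T))
    (hW : ∀ x, familyMap A x ∈ W) : IsClosedMap (toImage A) := by
  intro C hC
  have hclosed : IsClosed (restrict hAT '' closure (of T '' C)) :=
    (isClosed_closure.isCompact.image (continuous_restrict hAT)).isClosed
  convert hclosed.preimage (continuous_subtype_val (p := (· ∈ range (familyMap A)))) using 1
  ext y
  constructor
  · rintro ⟨x, hx, rfl⟩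
    exact ⟨of T x, subset_closure ⟨x, hx, rfl⟩, rfl⟩
  · rintro ⟨b, hb, hby⟩
    obtain ⟨x, rfl⟩ := surjective_toImage A y
    obtain ⟨x', rfl⟩ := hWT b (hby ▸ hW x)
    refine ⟨x', ?_, Subtype.ext hby⟩
    rwa [← hC.closure_eq, (isEmbedding_of hT).isInducing.closure_eq_preimage_closure_image]

end

/-! ### Skeletal and open maps; the final construction. -/

/-- A closed continuous map which is densely open at all points is open. -/
theorem IsClosedMap.isOpenMap_of_closure_image_mem_nhds {X Y : Type u} [TopologicalSpace X]
    [RegularSpace X] [TopologicalSpace Y] {p : X → Y} (hp : IsClosedMap p)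
    (h : ∀ x, ∀ O ∈ 𝓝 x, closure (p '' O) ∈ 𝓝 (p x)) : IsOpenMap p := by
  rw [isOpenMap_iff_nhds_le]
  intro x O hO
  obtain ⟨N, hN, hNc, hNO⟩ := exists_mem_nhds_isClosed_subset hO
  refine mem_of_superset (h x N hN) ?_
  rw [(hp N hNc).closure_eq]
  exact image_subset_iff.2 hNO

theorem isSkeletal_of_closure_image_mem_nhds {X Y : Type u} [TopologicalSpace X]
    [TopologicalSpace Y] {p : X → Y} (hp : Continuous p)
    (h : ∀ x, ∀ O ∈ 𝓝 x, closure (p '' O) ∈ 𝓝 (p x)) : IsSkeletal p :=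
  ⟨hp, fun U hU ⟨x, hx⟩ => ⟨p x, mem_interior_iff_mem_nhds.2 (h x U (hU.mem_nhds hx))⟩⟩

open FamilyClosure in
/-- The chain of families of functions which shows that a homogeneous space is Dugundji. -/
theorem IsOmegaNarrow.exists_familyChain {G : Type v} [Group G] [TopologicalSpace G]
    [IsTopologicalGroup G] (hG : IsOmegaNarrow G) {X : Type u} [TopologicalSpace X] [T35Space X]
    [MulAction G X] [ContinuousSMul G X] [MulAction.IsPretransitive G X] {D : Set X}
    (hDd : Dense D) (hD : IsCechComplete D) {K : ℕ → Set X} (hK : ∀ n, IsCompact (K n))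
    (hKD : ∀ n, K n ⊆ D) (hKd : Dense (⋃ n, K n)) :
    ∃ F : FamilyChain X,
      (∀ a, (∀ x, ∀ O ∈ 𝓝 x, closure (toImage (F.family a) '' O) ∈ 𝓝 (toImage (F.family a) x)) ∧
        (⋃ n, K n = univ → IsClosedMap (toImage (F.family a)))) ∧
      F.system.HasMetrizableSteps ∧ F.system.IsAlmostContinuous ∧ F.system.IsAlmostLimit X ∧
        F.system.IsFactorizing := by
  have := hD.baireSpace
  have : BaireSpace X := IsInducing.subtypeVal.baireSpace_of_denseRange hDd.denseRange_val
  have hopen : ∀ U ∈ 𝓝 (1 : G), ∀ x : X, closure ((fun g : G => g • x) '' U) ∈ 𝓝 x := by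
    intro U hU x
    simpa using hG.closure_image_mem_nhds Function.surjective_id
      (fun g : G => ⟨fun x => g • x, continuous_const_smul g, fun _ => rfl⟩) hU x
  let T := uniformFamily G X
  have hsep : ∀ x : X, ∀ O ∈ 𝓝 x, ∃ f ∈ T, f x = 0 ∧ ∀ y ∉ O, f y = 1 := fun x O hO =>
    exists_mem_uniformFamily hopen hO
  have hT : IsEmbedding (toImage T) := isEmbedding_toImage hsep
  have hof : IsEmbedding (of T) := isEmbedding_of hT
  have hGδ : IsGδ (of T '' D) := by
    rw [← Subtype.range_coe (s := D), ← range_comp]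
    exact hD.isGδ_range (hof.isInducing.comp IsInducing.subtypeVal)
      (denseRange_of.comp hDd.denseRange_val continuous_of)
  obtain ⟨A₀, hA₀T, hA₀, hW⟩ :=
    exists_countable_separating_family hGδ hK hKD pullback_mem_uniformFamily
  choose c hc hmem hcT hinv using fun f : T => hG.exists_countable_orbit f.2
  have := hA₀.to_subtype
  -- Whole countable sets of translates are included, not just `A₀`, so that every family stays
  -- invariant up to approximation.
  let Φ₀ : Set C(X, I) := ⋃ f : A₀, c ⟨f.1, hA₀T f.2⟩
  have hemb : IsEmbedding (toImage (Φ₀ ∪ ⋃ f, c f)) := isEmbedding_toImage fun x O hO => by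
    obtain ⟨f, hf, h⟩ := hsep x O hO
    exact ⟨f, Or.inr (mem_iUnion.2 ⟨⟨f, hf⟩, hmem _⟩), h⟩
  obtain ⟨F, hF, hFs⟩ := exists_familyChain_of_countable (countable_iUnion fun f => hc _) hc hemb
  refine ⟨F, fun a => ?_, hFs⟩
  obtain ⟨J, hJ⟩ := hF a
  have hJ' : ∀ f, f ∈ F.family a → ∃ i, f ∈ c i ∧ c i ⊆ F.family a := by
    rw [hJ]
    rintro f (hf | hf)
    · obtain ⟨i, hi⟩ := mem_iUnion.1 hf
      exact ⟨_, hi, (subset_iUnion (fun f : A₀ => c ⟨f.1, hA₀T f.2⟩) i).trans subset_union_left⟩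
    · obtain ⟨i, hiJ, hi⟩ := mem_iUnion₂.1 hf
      exact ⟨i, hi, (subset_biUnion_of_mem (u := c) hiJ).trans subset_union_right⟩
  have hAT : F.family a ⊆ T := fun f hf => by
    obtain ⟨i, hi, -⟩ := hJ' f hf
    exact hcT i hi
  have hA₀A : A₀ ⊆ F.family a := fun f hf => by
    rw [hJ]
    exact Or.inl (mem_iUnion.2 ⟨⟨f, hf⟩, hmem _⟩)
  obtain ⟨W, hWG, hWD, hKW⟩ := hW (F.family a) hAT hA₀A
  have hKW' : ∀ x ∈ ⋃ n, K n, familyMap (F.family a) x ∈ W := fun x hx => by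
    obtain ⟨n, hn⟩ := mem_iUnion.1 hx
    exact hKW n x hn
  have := FamilyImage.baireSpace hKd hWG hWD hKW'
  refine ⟨fun x O hO => ?_, fun huniv => isClosedMap_toImage hT
    (fun b hb => image_subset_range _ _ (hWD b hb)) fun x => hKW' x (huniv ▸ mem_univ x)⟩
  have hU : (fun g : G => g • x) ⁻¹' O ∈ 𝓝 (1 : G) :=
    (continuous_id.smul continuous_const).continuousAt (by simpa using hO)
  refine mem_of_superset (hG.closure_image_mem_nhds (surjective_toImage (F.family a))
    (FamilyImage.exists_smul fun f hf g ε hε => ?_) hU x)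
    (closure_mono (image_mono (image_preimage_subset _ _)))
  obtain ⟨i, hi, hic⟩ := hJ' f hf
  obtain ⟨f', hf', h⟩ := hinv i f hi g ε hε
  exact ⟨f', hic hf', h⟩

theorem corollary1p2 {G : Type v} [Group G] [TopologicalSpace G] [IsTopologicalGroup G]
    (hG : IsOmegaNarrow G)
    {X : Type u} [TopologicalSpace X] [T35Space X]
    [MulAction G X] [ContinuousSMul G X] [MulAction.IsPretransitive G X] :
    ((∃ D : Set X, Dense D ∧ IsCechComplete D ∧ IsKSeparable D) → IsSkeletallyDugundji X) ∧
      (IsCechComplete X → SigmaCompactSpace X → IsOpenlyDugundji X) := by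
  constructor
  · rintro ⟨D, hDd, hD, _, ⟨K, hK, rfl⟩, hKd⟩
    obtain ⟨F, hF, hFs⟩ := hG.exists_familyChain hDd hD
      (K := fun n => Subtype.val '' K n) (fun n => (hK n).image continuous_subtype_val)
      (fun n => Subtype.coe_image_subset D (K n)) (by
        rw [← image_iUnion]
        exact hDd.denseRange_val.dense_image continuous_subtype_val hKd)
    exact ⟨F.system, F.isSkeletal_map fun a =>
      isSkeletal_of_closure_image_mem_nhds (continuous_toImage _) (hF a).1, hFs⟩
  · intro hX _
    obtain ⟨F, hF, hFs⟩ := hG.exists_familyChain dense_univ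
      (hX.of_homeomorph (Homeomorph.Set.univ X).symm) (isCompact_compactCovering X)
      (fun n => subset_univ _) (by rw [iUnion_compactCovering]; exact dense_univ)
    exact ⟨F.system, F.isOpenMap_map fun a =>
      ((hF a).2 (iUnion_compactCovering X)).isOpenMap_of_closure_image_mem_nhds (hF a).1, hFs⟩
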